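/- Let $T\ge 1$, let $\mathcal F,\mathcal X$ be sets, let $(\mathcal B,\|\cdot\|)$ be a real normed space, $\mathcal H\subseteq\mathcal B$ and $\ell:\mathcal F\times\mathcal X\to\mathcal H$. Let $\Phi_T$ be a set of sequences $\boldsymbol\phi=(\phi_1,\dots,\phi_T)$ of maps $\phi_t:\mathcal H^{\mathcal F\times\mathcal X}\to\mathcal H^{\mathcal F\times\mathcal X}$, and write $\ell_{\phi_t}=\phi_t(\ell)$. A $\mathcal Z$-valued tree of depth $T$ is a sequence $\mathbf z=(\mathbf z_1,\dots,\mathbf z_T)$ of maps $\mathbf z_t:\{\pm1\}^{t-1}\to\mathcal Z$; for $\epsilon\in\{\pm1\}^T$ put $\mathbf z_t(\epsilon)=\mathbf z_t(\epsilon_1,\dots,\epsilon_{t-1})$. For a function $G:\mathcal B\to\mathbb R$ define the sequential complexity $$\mathcal R_T(\ell,\Phi_T)=\sup_{(\mathbf f,\mathbf x)}\ \mathbb E_{\epsilon}\ \sup_{\boldsymbol\phi\in\Phi_T} G\Big(\frac1T\sum_{t=1}^T\epsilon_t\,\ell_{\phi_t}(\mathbf f_t(\epsilon),\mathbf x_t(\epsilon))\Big),$$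 where the outer supremum is over all $(\mathcal F\times\mathcal X)$-valued trees of depth $T$ and $\epsilon$ is uniform on $\{\pm1\}^T$. A set $V$ of $\mathcal H$-valued trees of depth $T$ is an $\ell_\infty$ $\beta$-cover of $\Phi_T$ on $(\mathbf f,\mathbf x)$ if for all $\boldsymbol\phi\in\Phi_T$ and $\epsilon\in\{\pm1\}^T$ there is $\mathbf v\in V$ with $\max_{t}\|\mathbf v_t(\epsilon)-\ell_{\phi_t}(\mathbf f_t(\epsilon),\mathbf x_t(\epsilon))\|\le\beta$. Let $\mathcal N_\infty(\beta,\Phi_T,T)\in\mathbb N\cup\{\infty\}$ be the supremum over all trees $(\mathbf f,\mathbf x)$ of the least cardinality of such a cover. Assume that $G\ge 0$ is subadditive and $1$-Lipschitz with respect to $\|\cdot\|$, that $G(0)=0$, and that $G^2$ is $(\gamma,2)$-uniformly smooth, i.e. $\gamma\ge0$, $G^2$ has a gradient $\nabla G^2(z')\in\mathcal B^*$ at every $z'\in\mathcal B$, and $G^2(z)\le G^2(z')+\langle\nabla G^2(z'),z-z'\rangle+\frac\gamma2\|z-z'\|^2$ for all $z,z'\in\mathcal B$. Assume further that, for some $R\le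 1$, $\|\ell_{\phi_t}(f,x)\|\le R$ for all $f\in\mathcal F$, $x\in\mathcal X$, $\boldsymbol\phi\in\Phi_T$ and $t\le T$, and that $\mathcal N_\infty(R/4,\Phi_T,T)\ge 2$. Then $$\mathcal R_T(\ell,\Phi_T)\ \le\ 4\inf_{\alpha>0}\Big\{\alpha+6\sqrt{\frac{\gamma}{T}}\int_\alpha^1\sqrt{\log\mathcal N_\infty(\beta,\Phi_T,T)}\,d\beta\Big\},$$ where the integral may be $+\infty$ (with $0\cdot\infty=0$) and is $0$ if $\alpha\ge1$. -/

import Mathlib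

open scoped ENNReal

noncomputable section

namespace SeqDudley

/-- A `Z`-valued tree of depth `T`: for every round a function of the signs of the earlier rounds.
Rounds are numbered from `0`, so that round `t` is preceded by exactly `t` signs. -/
abbrev Tree (Z : Type*) (T : ℕ) : Type _ := (t : Fin T) → (Fin (t : ℕ) → ℤˣ) → Z

/-- The value `z_t(ε)` of the tree `z` in round `t` along the path `ε`; it depends only on the
signs before round `t`. -/
def Tree.at {Z : Type*} {T : ℕ} (z : Tree Z T) (ε : Fin T → ℤˣ) (t : Fin T) : Z :=
  z t (fun i => ε (Fin.castLE t.isLt.le i))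

/-- A payoff transformation maps payoff functions to payoff functions. -/
abbrev PayoffTransformation (F X : Type*) {E : Type*} (H : Set E) : Type _ :=
  (F → X → H) → (F → X → H)

section

variable {F X E : Type*} [NormedAddCommGroup E] [NormedSpace ℝ E] {H : Set E} {T : ℕ}

/-- The transformed payoff `ℓ_{φ_t}(f_t(ε), x_t(ε))` met in round `t` on the path `ε` of the
`(F × X)`-valued tree `fx`. -/
def payoffAlong (l : F → X → H) (φ : Fin T → PayoffTransformation F X H)
    (fx : Tree (F × X) T) (ε : Fin T → ℤˣ) (t : Fin T) : E :=
  (φ t l (fx.at ε t).1 (fx.at ε t).2 : E)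

/-- Sequential complexity of the class `Φ` of sequences of payoff transformations, with respect to
the payoff `l` and the cumulative payoff function `compare`: the supremum over trees of the
average over the `2 ^ T` sign paths of the supremum over `Φ`. -/
def seqComplexity (l : F → X → H) (Φ : Set (Fin T → PayoffTransformation F X H))
    (compare : (Fin T → E) → ℝ) : ℝ :=
  ⨆ fx : Tree (F × X) T,
    (∑ ε : Fin T → ℤˣ,
      ⨆ φ : Φ, compare (fun t => ((ε t : ℤ) : ℝ) • payoffAlong l φ.1 fx ε t)) / 2 ^ T

/-- `V` is an `α`-cover of `Φ` with respect to the `ℓ_∞` norm on the tree `fx`. The covering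
element may depend on the path. -/
def IsCoverOn (l : F → X → H) (Φ : Set (Fin T → PayoffTransformation F X H))
    (fx : Tree (F × X) T) (α : ℝ) (V : Set (Tree H T)) : Prop :=
  ∀ φ ∈ Φ, ∀ ε : Fin T → ℤˣ, ∃ v ∈ V, ∀ t : Fin T,
    ‖(v.at ε t : E) - payoffAlong l φ fx ε t‖ ≤ α

/-- The `ℓ_∞` covering number of `Φ` on the tree `fx` (`⊤` if there is no finite cover). -/
def coverNumOn (l : F → X → H) (Φ : Set (Fin T → PayoffTransformation F X H))
    (fx : Tree (F × X) T) (α : ℝ) : ℕ∞ :=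
  ⨅ (V : Set (Tree H T)) (_ : IsCoverOn l Φ fx α V), V.encard

/-- The maximal `ℓ_∞` covering number of `Φ` over all trees of depth `T`. -/
def coverNum (l : F → X → H) (Φ : Set (Fin T → PayoffTransformation F X H)) (α : ℝ) : ℕ∞ :=
  ⨆ fx : Tree (F × X) T, coverNumOn l Φ fx α

end

/-- `√(log n)`, with value `∞` at `n = ∞`. -/
def sqrtLog (n : ℕ∞) : ℝ≥0∞ :=
  if n = ⊤ then ⊤ else ENNReal.ofReal (Real.sqrt (Real.log (n.toNat : ℝ)))

/-- `f` is `(σ, p)`-uniformly smooth on the normed space `E`: it has a gradient (a continuous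
linear functional giving all directional derivatives; a Fréchet derivative is one) at every point,
and its first-order expansions are upper bounds up to the error `(σ / p) ‖z - z'‖ ^ p`. -/
def UniformlySmooth {E : Type*} [NormedAddCommGroup E] [NormedSpace ℝ E]
    (σ p : ℝ) (f : E → ℝ) : Prop :=
  0 ≤ σ ∧ 1 < p ∧ p ≤ 2 ∧
    ∀ z' : E, ∃ g : E →L[ℝ] ℝ, (∀ v : E, HasLineDerivAt ℝ f (g v) z' v) ∧
      ∀ z : E, f z ≤ f z' + g (z - z') + σ / p * ‖z - z'‖ ^ p

end SeqDudley

end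

/-!
The proof is chaining for predictable processes, with a maximal inequality that comes from
uniform smoothness instead of a sub-Gaussian increment condition.

*Maximal inequality.* Put `S = G ^ 2`. A nonnegative `γ`-smooth function is self-bounding: its
gradient satisfies `⟨∇S z, u⟩ ^ 2 ≤ 2 * γ * S z * ‖u‖ ^ 2` (`UniformlySmooth.exists_gradient`).
Hence, for a step `± u` with `‖u‖ ≤ b` and a fair sign, averaging `exp (S / y)` costs only a
decrease of `y` by `d = γ * b ^ 2` (`exp_smooth_step`), and over `T` rounds the exponential moment
of `S / (2 * d * T)` at a signed sum of steps of norm at most `b` is at most `exp (1 / 2)`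
(`sum_exp_smooth_le`). With a union bound, the maximum of `G` over `n ≥ 2` such averages has
expectation at most `2 * b * √(γ / T) * √(log n)` (`exists_majorant`); the additive constant `1 / 2`
is absorbed by `log n ≥ log 2`.

*Chaining.* The scales are `β / 2 ^ j` with `β = R / 4`, where the covering number is at least two.
The first increment leads from the zero tree to the cover at scale `β`, so that the scale `R / 2`,
where the covering number may be one, is skipped. The element of a cover that approximates a
transformation depends on the path. So the increments are all differences of elements of
consecutive covers, truncated where they are large, and the suprema are handled through one
dominating function `Q` of the path (`exists_chain`).

*Integral.* The dyadic sum is a lower Riemann sum of the antitone integrand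
(`sum_dyadic_le_setLIntegral`). Values of `α` just below `R / 4` leave no room for such a sum and
are treated by interpolating between the trivial bound `R` and the bound with one scale
(`seqComplexity_le_integral`).
-/

namespace SeqDudley

/-! ### Predictable processes and signed sums -/

section

variable {Z E : Type*} {T : ℕ}

/-- A process along sign paths is predictable if its value in round `t` depends only on the signs
before round `t`. -/
def IsPredictable (f : (Fin T → ℤˣ) → Fin T → Z) : Prop :=
  ∀ ε ε' t, (∀ s < t, ε s = ε' s) → f ε t = f ε' t

theorem Tree.isPredictable (z : Tree Z T) : IsPredictable z.at := fun ε ε' t h => by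
  unfold Tree.at
  congr 1
  funext i
  exact h _ i.isLt

variable [NormedAddCommGroup E] [NormedSpace ℝ E]

/-- The sum of a process with the signs of the path. -/
noncomputable def signedSum (f : (Fin T → ℤˣ) → Fin T → E) (ε : Fin T → ℤˣ) : E :=
  ∑ t, ((ε t : ℤ) : ℝ) • f ε t

theorem norm_sign_smul (e : ℤˣ) (v : E) : ‖((e : ℤ) : ℝ) • v‖ = ‖v‖ := by
  rcases Int.units_eq_one_or e with rfl | rfl <;> simp

theorem norm_inv_smul_sum_sign_le (hT : 1 ≤ T) {ε : Fin T → ℤˣ} {w : Fin T → E} {b : ℝ}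
    (hw : ∀ t, ‖w t‖ ≤ b) : ‖(T : ℝ)⁻¹ • ∑ t, ((ε t : ℤ) : ℝ) • w t‖ ≤ b := by
  have hT' : (0 : ℝ) < T := by exact_mod_cast hT
  have h : ‖∑ t, ((ε t : ℤ) : ℝ) • w t‖ ≤ T * b := by
    refine (norm_sum_le _ _).trans ?_
    calc ∑ t, ‖((ε t : ℤ) : ℝ) • w t‖ ≤ ∑ _t : Fin T, b :=
          Finset.sum_le_sum fun t _ => by rw [norm_sign_smul]; exact hw t
      _ = T * b := by simp
  rw [norm_smul, norm_inv, Real.norm_natCast, inv_mul_le_iff₀ hT']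
  exact h

theorem sum_signs_succ (h : (Fin (T + 1) → ℤˣ) → ℝ) :
    ∑ ε, h ε = ∑ ε : Fin T → ℤˣ, h (Fin.cons 1 ε) + ∑ ε : Fin T → ℤˣ, h (Fin.cons (-1) ε) := by
  rw [← (Fin.consEquiv (fun _ => ℤˣ)).sum_comp, Fintype.sum_prod_type]
  have : (Finset.univ : Finset ℤˣ) = {1, -1} := rfl
  rw [this, Finset.sum_pair (by decide)]
  rfl

/-! ### A maximal inequality from uniform smoothness -/

/-- The gradient of a nonnegative smooth function is controlled by the value of the function: the
upper bound along a line is a nonnegative quadratic polynomial, whose discriminant is at most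
zero. -/
theorem UniformlySmooth.exists_gradient {γ : ℝ} {S : E → ℝ} (hS : UniformlySmooth γ 2 S)
    (hS0 : ∀ z, 0 ≤ S z) (z : E) :
    ∃ g : E →L[ℝ] ℝ, (∀ u, g u ^ 2 ≤ 2 * γ * S z * ‖u‖ ^ 2) ∧
      ∀ u, S (z + u) ≤ S z + g u + γ / 2 * ‖u‖ ^ 2 := by
  obtain ⟨-, -, -, h⟩ := hS
  obtain ⟨g, -, hg⟩ := h z
  have hup : ∀ u, S (z + u) ≤ S z + g u + γ / 2 * ‖u‖ ^ 2 := fun u => by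
    simpa using hg (z + u)
  refine ⟨g, fun u => ?_, hup⟩
  have hq : ∀ r : ℝ, 0 ≤ (γ / 2 * ‖u‖ ^ 2) * (r * r) + g u * r + S z := fun r => by
    have h1 := (hS0 _).trans (hup (r • u))
    rw [norm_smul, mul_pow, Real.norm_eq_abs, sq_abs, map_smul, smul_eq_mul] at h1
    linarith
  have := discrim_le_zero hq
  unfold discrim at this
  linarith

/-- One fair sign. The quantity `y` is the inverse of the exponential weight; a step of norm at
most `b` costs a decrease of `y` by `γ * b ^ 2`. -/
theorem exp_smooth_step {γ : ℝ} {S : E → ℝ} (hS : UniformlySmooth γ 2 S)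
    (hS0 : ∀ z, 0 ≤ S z) {b y : ℝ} (hy : γ * b ^ 2 < y) (z u : E) (hu : ‖u‖ ≤ b) :
    Real.exp (S (z + u) / y) + Real.exp (S (z - u) / y) ≤
      2 * Real.exp ((S z + γ * b ^ 2 / 2) / (y - γ * b ^ 2)) := by
  obtain ⟨g, hg, hup⟩ := hS.exists_gradient hS0 z
  have hγ : 0 ≤ γ := hS.1
  set d := γ * b ^ 2 with hd
  have hub : ‖u‖ ^ 2 ≤ b ^ 2 := by gcongr
  have hd0 : 0 ≤ d := by positivity
  have hy0 : 0 < y := hd0.trans_lt hy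
  have hdu : γ * ‖u‖ ^ 2 ≤ d := mul_le_mul_of_nonneg_left hub hγ
  have hgd : g u ^ 2 ≤ 2 * d * S z := by nlinarith [hg u, hS0 z]
  have h1 : S (z + u) / y ≤ (S z + d / 2) / y + g u / y := by
    rw [← add_div]; gcongr; linarith [hup u]
  have h2 : S (z - u) / y ≤ (S z + d / 2) / y + -(g u / y) := by
    rw [← neg_div, ← add_div]; gcongr
    have := hup (-u)
    rw [← sub_eq_add_neg, norm_neg, map_neg] at this
    linarith
  have hcosh : Real.exp (g u / y) + Real.exp (-(g u / y)) ≤ 2 * Real.exp (d * S z / y ^ 2) := by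
    have h3 := Real.cosh_le_exp_half_sq (g u / y)
    have h4 : (g u / y) ^ 2 / 2 ≤ d * S z / y ^ 2 := by
      rw [div_pow, div_div, mul_comm, ← div_div]
      gcongr
      linarith
    rw [Real.cosh_eq] at h3
    linarith [Real.exp_le_exp.2 h4]
  have hfin : (S z + d / 2) / y + d * S z / y ^ 2 ≤ (S z + d / 2) / (y - d) := by
    have hyd : 0 < y - d := by linarith
    have hz := hS0 z
    rw [div_add_div _ _ hy0.ne' (by positivity), div_le_div_iff₀ (by positivity) hyd]
    have : 0 ≤ y * (d ^ 2 * S z + y * d ^ 2 / 2) := by positivity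
    nlinarith
  calc Real.exp (S (z + u) / y) + Real.exp (S (z - u) / y)
      ≤ Real.exp ((S z + d / 2) / y + g u / y) + Real.exp ((S z + d / 2) / y + -(g u / y)) := by
        gcongr
    _ = Real.exp ((S z + d / 2) / y) * (Real.exp (g u / y) + Real.exp (-(g u / y))) := by
        rw [Real.exp_add, Real.exp_add]; ring
    _ ≤ Real.exp ((S z + d / 2) / y) * (2 * Real.exp (d * S z / y ^ 2)) := by gcongr
    _ = 2 * Real.exp ((S z + d / 2) / y + d * S z / y ^ 2) := by rw [Real.exp_add]; ring
    _ ≤ _ := by gcongr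

/-- The exponential moment of a nonnegative smooth function of a signed predictable sum. Iterating
the one-step bound lowers the inverse weight `x` by `γ * b ^ 2` in every round. -/
theorem sum_exp_smooth_le {γ : ℝ} {S : E → ℝ} (hS : UniformlySmooth γ 2 S)
    (hS0 : ∀ z, 0 ≤ S z) {b x : ℝ} (f : (Fin T → ℤˣ) → Fin T → E) (hf : IsPredictable f)
    (hb : ∀ ε t, ‖f ε t‖ ≤ b) (z : E) (hx : γ * b ^ 2 * T < x) :
    ∑ ε, Real.exp (S (z + signedSum f ε) / x) ≤
      2 ^ T * Real.exp ((S z + γ * b ^ 2 / 2 * T) / (x - γ * b ^ 2 * T)) := by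
  induction T generalizing z with
  | zero => simp [signedSum]
  | succ T ih =>
    have hd0 : 0 ≤ γ * b ^ 2 := mul_nonneg hS.1 (sq_nonneg b)
    set d := γ * b ^ 2 with hd
    push_cast at hx
    have hxT : 0 < x - d * T := by nlinarith
    have hxT' : 0 < x - d * T - d := by linarith
    have hu : ∀ ε, f ε 0 = f 1 0 := fun ε => hf _ _ _ fun s hs => absurd hs (Fin.not_lt_zero s)
    have hsub : ∀ e : ℤˣ, ∑ ε : Fin T → ℤˣ,
        Real.exp (S (z + signedSum f (Fin.cons e ε)) / x) ≤
        2 ^ T * Real.exp ((S (z + ((e : ℤ) : ℝ) • f 1 0) + d / 2 * T) / (x - d * T)) := by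
      intro e
      have h := ih (fun ε t => f (Fin.cons e ε) t.succ) (fun ε ε' t h => hf _ _ _ fun s hs => by
        induction s using Fin.cases with
        | zero => rfl
        | succ s => simpa using h s (Fin.succ_lt_succ_iff.1 hs))
        (fun ε t => hb _ _) (z + ((e : ℤ) : ℝ) • f 1 0) (by linarith)
      refine le_of_eq_of_le (Finset.sum_congr rfl fun ε _ => ?_) h
      simp only [signedSum, Fin.sum_univ_succ, Fin.cons_zero, Fin.cons_succ, hu, add_assoc]
    have hstep := exp_smooth_step hS hS0 (b := b) (y := x - d * T) (by linarith) z (f 1 0) (hb _ _)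
    rw [← hd] at hstep
    rw [sum_signs_succ]
    have h1 := hsub 1
    have h2 := hsub (-1)
    simp only [Units.val_one, Int.cast_one, one_smul, Units.val_neg, Int.cast_neg, neg_smul,
      ← sub_eq_add_neg, add_div _ (d / 2 * T) (x - d * T), Real.exp_add] at h1 h2
    set c := Real.exp (d / 2 * T / (x - d * T)) with hc
    calc _ ≤ 2 ^ T * ((Real.exp (S (z + f 1 0) / (x - d * T)) +
            Real.exp (S (z - f 1 0) / (x - d * T))) * c) := by linarith
      _ ≤ 2 ^ T * (2 * Real.exp ((S z + d / 2) / (x - d * T - d)) *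
            Real.exp (d / 2 * T / (x - d * T - d))) := by
          have hc' : c ≤ Real.exp (d / 2 * T / (x - d * T - d)) :=
            Real.exp_le_exp.2 (div_le_div_of_nonneg_left (by positivity) hxT' (by linarith))
          gcongr
      _ = 2 ^ (T + 1) * Real.exp ((S z + d / 2 * ↑(T + 1)) / (x - d * ↑(T + 1))) := by
          rw [mul_assoc 2, ← Real.exp_add, ← add_div]
          push_cast
          rw [show S z + d / 2 + d / 2 * T = S z + d / 2 * (T + 1) by ring,
            show x - d * T - d = x - d * (T + 1) by ring]
          ring

/-- The maximal inequality for finitely many predictable processes, in the form of a single random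
variable `Q` that dominates all of them at once. A process need only be bounded on the path under
consideration: off such paths it is truncated, which keeps it predictable. -/
theorem exists_majorant {ι : Type*} [Fintype ι] {G : E → ℝ} {γ B : ℝ} (hγ : 0 < γ) (hB : 0 < B)
    (hT : 1 ≤ T) (hG0 : G 0 = 0)
    (hS : UniformlySmooth γ 2 (fun z => G z ^ 2)) {n : ℕ} (hn : 2 ≤ n)
    (hcard : Fintype.card ι ≤ n) (f : ι → (Fin T → ℤˣ) → Fin T → E)
    (hf : ∀ i, IsPredictable (f i)) :
    ∃ Q : (Fin T → ℤˣ) → ℝ,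
      (∑ ε, Q ε) / 2 ^ T ≤ 2 * B * √(γ / T) * √(Real.log n) ∧
      ∀ i ε, (∀ t, ‖f i ε t‖ ≤ B) → G ((T : ℝ)⁻¹ • signedSum (f i) ε) ≤ Q ε := by
  classical
  have hT' : (0 : ℝ) < T := by exact_mod_cast hT
  set f' : ι → (Fin T → ℤˣ) → Fin T → E :=
    fun i ε t => if ‖f i ε t‖ ≤ B then (T : ℝ)⁻¹ • f i ε t else 0 with hf'
  have hf'p : ∀ i, IsPredictable (f' i) := fun i ε ε' t h => by
    simp only [hf', hf i ε ε' t h]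
  have hf'b : ∀ i ε t, ‖f' i ε t‖ ≤ B / T := fun i ε t => by
    simp only [hf']
    split_ifs with h
    · rw [norm_smul, norm_inv, Real.norm_natCast, inv_mul_eq_div]
      gcongr
    · simp only [norm_zero]; positivity
  have hlog : (1 : ℝ) / 2 ≤ Real.log n := by
    have h2 : Real.log 2 ≤ Real.log n := Real.log_le_log (by norm_num) (by exact_mod_cast hn)
    linarith [Real.log_two_gt_d9]
  set d := γ * (B / T) ^ 2 with hd
  have hd0 : 0 < d := by positivity
  -- Half of the inverse weight `x` is used up over the `T` rounds.
  set x := 2 * (d * T) with hx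
  have hx0 : 0 < x := by positivity
  set m := Real.log n + 1 / 2 with hm
  have hm0 : 0 < m := by linarith
  set K := √(x * m) with hK
  have hK0 : 0 < K := Real.sqrt_pos.2 (by positivity)
  have hKK : K ^ 2 = x * m := Real.sq_sqrt (by positivity)
  have hexp : ∀ i, ∑ ε, Real.exp (G (signedSum (f' i) ε) ^ 2 / x) ≤
      2 ^ T * Real.exp (1 / 2) := fun i => by
    have h := sum_exp_smooth_le hS (fun z => sq_nonneg _) (f' i) (hf'p i) (hf'b i) 0 (x := x)
      (by rw [← hd, hx]; nlinarith [mul_pos hd0 hT'])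
    rw [← hd] at h
    have h3 : (G 0 ^ 2 + d / 2 * T) / (x - d * T) = 1 / 2 := by
      rw [hG0, hx]; field_simp; ring
    simpa only [h3, zero_add] using h
  have hnm : (n : ℝ) * Real.exp (1 / 2) * Real.exp (-m) = 1 := by
    have hn0 : (0 : ℝ) < n := by positivity
    nth_rw 1 [← Real.exp_log hn0]
    rw [← Real.exp_add, ← Real.exp_add, hm]
    simp
  set P : (Fin T → ℤˣ) → ℝ := fun ε =>
    ∑ i, Real.exp (G (signedSum (f' i) ε) ^ 2 / x) * Real.exp (-m) with hP
  have hPsum : ∑ ε, P ε ≤ 2 ^ T := by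
    rw [hP, Finset.sum_comm]
    calc _ ≤ ∑ _i : ι, 2 ^ T * Real.exp (1 / 2) * Real.exp (-m) :=
          Finset.sum_le_sum fun i _ => by rw [← Finset.sum_mul]; gcongr; exact hexp i
      _ = Fintype.card ι * (2 ^ T * Real.exp (1 / 2) * Real.exp (-m)) := by simp
      _ ≤ n * (2 ^ T * Real.exp (1 / 2) * Real.exp (-m)) := by gcongr
      _ = 2 ^ T * (n * Real.exp (1 / 2) * Real.exp (-m)) := by ring
      _ = 2 ^ T := by rw [hnm, mul_one]
  refine ⟨fun ε => (K + x / K * (P ε - 1 + m)) / 2, ?_, fun i ε hi => ?_⟩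
  · have hcardε : ((Finset.univ : Finset (Fin T → ℤˣ)).card : ℝ) = 2 ^ T := by simp
    have hsum : ∑ ε, (K + x / K * (P ε - 1 + m)) / 2 ≤ 2 ^ T * K := by
      rw [← Finset.sum_div, Finset.sum_add_distrib, ← Finset.mul_sum, Finset.sum_add_distrib,
        Finset.sum_sub_distrib]
      simp only [Finset.sum_const, nsmul_eq_mul, hcardε, mul_one]
      have h1 : x / K * (∑ ε, P ε - 2 ^ T + 2 ^ T * m) ≤ x / K * (2 ^ T * m) := by
        gcongr; linarith
      have h2 : x / K * (2 ^ T * m) = 2 ^ T * K := by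
        field_simp; linarith
      linarith
    have hKle : K ≤ 2 * B * √(γ / T) * √(Real.log n) := by
      rw [hK]
      apply Real.sqrt_le_iff.2
      refine ⟨by positivity, ?_⟩
      rw [mul_pow, mul_pow, Real.sq_sqrt (by positivity), Real.sq_sqrt (by linarith)]
      have hxe : x = 2 * B ^ 2 * (γ / T) := by rw [hx, hd]; field_simp
      have h0 : 0 ≤ B ^ 2 * (γ / T) := by positivity
      rw [hxe, hm]
      nlinarith
    rw [div_le_iff₀ (by positivity)]
    nlinarith [pow_pos (two_pos (α := ℝ)) T]
  · have hfe : (T : ℝ)⁻¹ • signedSum (f i) ε = signedSum (f' i) ε := by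
      simp only [signedSum, hf', hi, if_true, Finset.smul_sum]
      exact Finset.sum_congr rfl fun t _ => smul_comm _ _ _
    rw [hfe]
    set g := G (signedSum (f' i) ε) with hg
    have h1 : Real.exp (g ^ 2 / x) * Real.exp (-m) ≤ P ε :=
      Finset.single_le_sum
        (f := fun i => Real.exp (G (signedSum (f' i) ε) ^ 2 / x) * Real.exp (-m))
        (fun i _ => by positivity) (Finset.mem_univ i)
    rw [← Real.exp_add] at h1
    have h2 : g ^ 2 / x ≤ P ε - 1 + m := by
      linarith [Real.add_one_le_exp (g ^ 2 / x + -m)]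
    have h3 : g ^ 2 / K ≤ x / K * (P ε - 1 + m) := by
      calc g ^ 2 / K = x / K * (g ^ 2 / x) := by field_simp
        _ ≤ _ := by gcongr
    have h4 : 2 * g ≤ K + g ^ 2 / K := by
      have : K + g ^ 2 / K - 2 * g = (K - g) ^ 2 / K := by field_simp; ring
      have : 0 ≤ (K - g) ^ 2 / K := by positivity
      linarith
    linarith

end

/-! ### Covering numbers -/

section

variable {F X E : Type*} [NormedAddCommGroup E] {H : Set E} {T : ℕ}
  {l : F → X → H} {Φ : Set (Fin T → PayoffTransformation F X H)}

theorem coverNum_antitone : Antitone (coverNum l Φ) := fun _ _ hab =>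
  iSup_mono fun _ => le_iInf₂ fun V hV => iInf₂_le V fun φ hφ ε =>
    let ⟨v, hv, h⟩ := hV φ hφ ε
    ⟨v, hv, fun t => (h t).trans hab⟩

theorem sqrtLog_mono : Monotone sqrtLog := fun m n hmn => by
  unfold sqrtLog
  by_cases hn : n = ⊤
  · simp [hn]
  have hm : m ≠ ⊤ := ne_top_of_le_ne_top hn hmn
  rw [if_neg hn, if_neg hm]
  refine ENNReal.ofReal_le_ofReal (Real.sqrt_le_sqrt ?_)
  rcases Nat.eq_zero_or_pos m.toNat with h | h
  · rw [h]; simpa using Real.log_natCast_nonneg _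
  · exact Real.log_le_log (by exact_mod_cast h) (by exact_mod_cast ENat.toNat_le_toNat hmn hn)

theorem exists_cover (fx : Tree (F × X) T) {β : ℝ} (hβ : coverNum l Φ β ≠ ⊤) :
    ∃ V : Set (Tree H T), IsCoverOn l Φ fx β V ∧ V.encard ≤ coverNum l Φ β := by
  have h : coverNumOn l Φ fx β < coverNum l Φ β + 1 :=
    (ENat.lt_add_one_iff hβ).2 (le_iSup (fun fx => coverNumOn l Φ fx β) fx)
  simp only [coverNumOn, iInf_lt_iff] at h
  obtain ⟨V, hV, h⟩ := h
  exact ⟨V, hV, (ENat.lt_add_one_iff hβ).1 h⟩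

theorem nonempty_of_coverNum {β : ℝ} (h : 2 ≤ coverNum l Φ β) : Φ.Nonempty := by
  by_contra hΦ
  rw [Set.not_nonempty_iff_eq_empty] at hΦ
  have h0 : coverNum l Φ β ≤ 0 := iSup_le fun fx =>
    (iInf₂_le (∅ : Set (Tree H T)) (by simp [IsCoverOn, hΦ])).trans (by simp)
  exact absurd (h.trans h0) (by decide)

end

/-! ### Chaining over dyadic scales -/

section

variable {F X E : Type*} [NormedAddCommGroup E] [NormedSpace ℝ E] {H : Set E} {T : ℕ}
  {l : F → X → H} {Φ : Set (Fin T → PayoffTransformation F X H)}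

/-- Chaining over the scales `β / 2 ^ j` for `j ≤ N`, starting at the zero tree. Along a path, the
increments between consecutive covers have norm at most `3 * β / 2 ^ j`; the first increment, the
cover at scale `β` itself, has norm at most `4 * β + β`. -/
theorem exists_chain {G : E → ℝ} {γ β : ℝ} (hT : 1 ≤ T) (hγ : 0 < γ) (hβ : 0 < β)
    (hG0 : G 0 = 0) (hGadd : ∀ z w, G (z + w) ≤ G z + G w)
    (hS : UniformlySmooth γ 2 (fun z => G z ^ 2))
    (hbound : ∀ φ ∈ Φ, ∀ (t : Fin T) (f : F) (x : X), ‖(φ t l f x : E)‖ ≤ 4 * β)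
    (hrich : 2 ≤ coverNum l Φ β) (fx : Tree (F × X) T) (N : ℕ)
    (hfin : coverNum l Φ (β / 2 ^ N) ≠ ⊤) :
    ∃ V : Set (Tree H T), IsCoverOn l Φ fx (β / 2 ^ N) V ∧
      V.encard ≤ coverNum l Φ (β / 2 ^ N) ∧
      ∃ Q : (Fin T → ℤˣ) → ℝ,
        (∑ ε, Q ε) / 2 ^ T ≤ 10 * √(γ / T) * ∑ j ∈ Finset.range (N + 1),
          β / 2 ^ j * √(Real.log (coverNum l Φ (β / 2 ^ j)).toNat) ∧
        ∀ v ∈ V, ∀ φ ∈ Φ, ∀ ε, (∀ t, ‖(v.at ε t : E) - payoffAlong l φ fx ε t‖ ≤ β / 2 ^ N) →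
          G ((T : ℝ)⁻¹ • signedSum (fun ε t => (v.at ε t : E)) ε) ≤ Q ε := by
  induction N with
  | zero =>
    simp only [pow_zero, div_one] at hfin
    obtain ⟨V, hV, hcard⟩ := exists_cover fx hfin
    have hVfin : V.Finite := Set.encard_ne_top_iff.1 (ne_top_of_le_ne_top hfin hcard)
    have := hVfin.fintype
    have hn : 2 ≤ (coverNum l Φ β).toNat := ENat.toNat_le_toNat hrich hfin
    obtain ⟨Q, hQ, hQ'⟩ := exists_majorant (ι := V) (B := 5 * β) hγ (by positivity) hT hG0 hS hn
      (by
        rw [← Nat.card_eq_fintype_card, Nat.card_coe_set_eq]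
        exact ENat.toNat_le_toNat hcard hfin)
      (fun v ε t => (v.1.at ε t : E))
      (fun v ε ε' t h => congrArg Subtype.val (v.1.isPredictable ε ε' t h))
    refine ⟨V, by simpa using hV, by simpa using hcard, Q, ?_, fun v hv φ hφ ε h =>
      hQ' ⟨v, hv⟩ ε fun t => ?_⟩
    · refine hQ.trans (le_of_eq ?_)
      simp only [zero_add, Finset.range_one, Finset.sum_singleton, pow_zero, div_one]
      ring
    · have h1 := h t
      simp only [pow_zero, div_one] at h1
      have h2 : ‖payoffAlong l φ fx ε t‖ ≤ 4 * β := hbound φ hφ t _ _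
      have h3 := norm_add_le ((v.at ε t : E) - payoffAlong l φ fx ε t) (payoffAlong l φ fx ε t)
      rw [sub_add_cancel] at h3
      linarith
  | succ N ih =>
    set b := β / 2 ^ (N + 1) with hb
    have hb0 : 0 < b := by positivity
    have hbN : β / 2 ^ N = 2 * b := by rw [hb, pow_succ]; field_simp
    have hle : coverNum l Φ (β / 2 ^ N) ≤ coverNum l Φ b :=
      coverNum_antitone (by rw [hbN]; linarith)
    obtain ⟨V, hV, hcard, Q, hQ, hQ'⟩ := ih (ne_top_of_le_ne_top hfin hle)
    rw [hbN] at hV hQ'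
    have hcard := hcard.trans hle
    obtain ⟨V', hV', hcard'⟩ := exists_cover fx hfin
    have := (Set.encard_ne_top_iff.1 (ne_top_of_le_ne_top hfin hcard)).fintype
    have := (Set.encard_ne_top_iff.1 (ne_top_of_le_ne_top hfin hcard')).fintype
    have hrich' : 2 ≤ coverNum l Φ b := hrich.trans (coverNum_antitone (by
      rw [hb]; exact div_le_self hβ.le (one_le_pow₀ (by norm_num))))
    set n := (coverNum l Φ b).toNat with hn
    have hn2 : 2 ≤ n := ENat.toNat_le_toNat hrich' hfin
    have hc : Fintype.card V ≤ n := by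
      rw [← Nat.card_eq_fintype_card, Nat.card_coe_set_eq]
      exact ENat.toNat_le_toNat hcard hfin
    have hc' : Fintype.card V' ≤ n := by
      rw [← Nat.card_eq_fintype_card, Nat.card_coe_set_eq]
      exact ENat.toNat_le_toNat hcard' hfin
    obtain ⟨P, hP, hP'⟩ := exists_majorant (ι := V' × V) (B := 3 * b) (n := n ^ 2) hγ
      (by positivity) hT hG0 hS (by nlinarith)
      (by rw [Fintype.card_prod, sq]; exact Nat.mul_le_mul hc' hc)
      (fun v ε t => (v.1.1.at ε t : E) - (v.2.1.at ε t : E))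
      (fun v ε ε' t h => by simp only [Tree.isPredictable _ ε ε' t h])
    refine ⟨V', hV', hcard', fun ε => Q ε + P ε, ?_, fun v' hv' φ hφ ε h' => ?_⟩
    · rw [Finset.sum_add_distrib, add_div, Finset.sum_range_succ, mul_add]
      refine add_le_add hQ (hP.trans ?_)
      have hlog : √(Real.log ((n ^ 2 : ℕ) : ℝ)) ≤ 3 / 2 * √(Real.log n) := by
        rw [Nat.cast_pow, Real.log_pow, Nat.cast_ofNat]
        refine Real.sqrt_le_iff.2 ⟨by positivity, ?_⟩
        have hl := Real.log_natCast_nonneg n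
        rw [mul_pow, Real.sq_sqrt hl]
        linarith
      calc _ ≤ 2 * (3 * b) * √(γ / T) * (3 / 2 * √(Real.log n)) := by gcongr
        _ = 9 * (√(γ / T) * (b * √(Real.log n))) := by ring
        _ ≤ 10 * (√(γ / T) * (b * √(Real.log n))) := by gcongr; norm_num
        _ = _ := by ring
    · obtain ⟨v, hv, h⟩ := hV φ hφ ε
      have h1 := hQ' v hv φ hφ ε h
      have h2 := hP' (⟨v', hv'⟩, ⟨v, hv⟩) ε fun t => by
        have h3 := norm_sub_le ((v'.at ε t : E) - payoffAlong l φ fx ε t)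
          ((v.at ε t : E) - payoffAlong l φ fx ε t)
        rw [sub_sub_sub_cancel_right] at h3
        linarith [h t, h' t]
      refine le_trans ?_ (add_le_add h1 h2)
      refine le_of_eq_of_le (congrArg G ?_) (hGadd _ _)
      rw [← smul_add]
      simp only [signedSum, ← Finset.sum_add_distrib, ← smul_add, add_sub_cancel]

/-- Dominating the supremum over `Φ` path by path avoids any boundedness side
condition on real suprema. -/
theorem seqComplexity_le_of_majorant {c : (Fin T → E) → ℝ} {b : ℝ} (hb : 0 ≤ b)
    (hΦ : Φ.Nonempty)
    (h : ∀ fx : Tree (F × X) T, ∃ Q : (Fin T → ℤˣ) → ℝ, (∑ ε, Q ε) / 2 ^ T ≤ b ∧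
      ∀ φ ∈ Φ, ∀ ε, c (fun t => ((ε t : ℤ) : ℝ) • payoffAlong l φ fx ε t) ≤ Q ε) :
    seqComplexity l Φ c ≤ b := by
  have := hΦ.to_subtype
  refine Real.iSup_le (fun fx => ?_) hb
  obtain ⟨Q, hQ, hQ'⟩ := h fx
  refine le_trans ?_ hQ
  gcongr with ε
  exact ciSup_le fun φ => hQ' φ.1 φ.2 ε

/-- The chaining bound with finitely many scales. -/
theorem seqComplexity_le_chain {G : E → ℝ} {γ β : ℝ} (hT : 1 ≤ T) (hγ : 0 < γ) (hβ : 0 < β)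
    (hG0 : G 0 = 0) (hGadd : ∀ z w, G (z + w) ≤ G z + G w) (hGle : ∀ z, G z ≤ ‖z‖)
    (hS : UniformlySmooth γ 2 (fun z => G z ^ 2))
    (hbound : ∀ φ ∈ Φ, ∀ (t : Fin T) (f : F) (x : X), ‖(φ t l f x : E)‖ ≤ 4 * β)
    (hrich : 2 ≤ coverNum l Φ β) (N : ℕ) (hfin : coverNum l Φ (β / 2 ^ N) ≠ ⊤) :
    seqComplexity l Φ (fun z => G ((T : ℝ)⁻¹ • ∑ t, z t)) ≤
      β / 2 ^ N + 10 * √(γ / T) * ∑ j ∈ Finset.range (N + 1),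
        β / 2 ^ j * √(Real.log (coverNum l Φ (β / 2 ^ j)).toNat) := by
  refine seqComplexity_le_of_majorant (by positivity) (nonempty_of_coverNum hrich) fun fx => ?_
  obtain ⟨V, hV, -, Q, hQ, hQ'⟩ :=
    exists_chain hT hγ hβ hG0 hGadd hS hbound hrich fx N hfin
  refine ⟨fun ε => β / 2 ^ N + Q ε, ?_, fun φ hφ ε => ?_⟩
  · rw [Finset.sum_add_distrib, add_div]
    refine add_le_add (le_of_eq ?_) hQ
    simp
  · obtain ⟨v, hv, h⟩ := hV φ hφ ε
    have h1 := hQ' v hv φ hφ ε h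
    have h2 : G ((T : ℝ)⁻¹ •
        ∑ t, ((ε t : ℤ) : ℝ) • (payoffAlong l φ fx ε t - (v.at ε t : E))) ≤ β / 2 ^ N :=
      (hGle _).trans (norm_inv_smul_sum_sign_le hT fun t => by rw [norm_sub_rev]; exact h t)
    refine le_trans ?_ (add_le_add h2 h1)
    refine le_of_eq_of_le (congrArg G ?_) (hGadd _ _)
    rw [← smul_add]
    simp only [signedSum, ← Finset.sum_add_distrib, ← smul_add, sub_add_cancel]

theorem seqComplexity_le_bound {G : E → ℝ} {b : ℝ} (hT : 1 ≤ T) (hb : 0 ≤ b)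
    (hΦ : Φ.Nonempty) (hGle : ∀ z, G z ≤ ‖z‖)
    (hbound : ∀ φ ∈ Φ, ∀ (t : Fin T) (f : F) (x : X), ‖(φ t l f x : E)‖ ≤ b) :
    seqComplexity l Φ (fun z => G ((T : ℝ)⁻¹ • ∑ t, z t)) ≤ b :=
  seqComplexity_le_of_majorant hb hΦ fun fx => ⟨fun _ => b, by simp, fun φ hφ ε =>
    (hGle _).trans (norm_inv_smul_sum_sign_le hT fun t => hbound φ hφ t _ _)⟩

/-! ### Comparison with the entropy integral -/

theorem mul_le_setLIntegral_Ioc {h : ℝ → ℝ≥0∞} (hh : Antitone h) (a b : ℝ) :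
    ENNReal.ofReal (b - a) * h b ≤ ∫⁻ x in Set.Ioc a b, h x := by
  calc ENNReal.ofReal (b - a) * h b = ∫⁻ _ in Set.Ioc a b, h b := by
        rw [MeasureTheory.setLIntegral_const, Real.volume_Ioc, mul_comm]
    _ ≤ _ := MeasureTheory.setLIntegral_mono' measurableSet_Ioc fun x hx => hh hx.2

theorem sum_dyadic_le_setLIntegral {h : ℝ → ℝ≥0∞} (hh : Antitone h) {β : ℝ} (hβ : 0 < β)
    (N : ℕ) :
    ∑ j ∈ Finset.range (N + 1), ENNReal.ofReal (β / 2 ^ j / 2) * h (β / 2 ^ j) ≤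
      ∫⁻ x in Set.Ioc (β / 2 ^ (N + 1)) β, h x := by
  induction N with
  | zero =>
    have := mul_le_setLIntegral_Ioc hh (β / 2) β
    rw [sub_half] at this
    simpa using this
  | succ N ih =>
    rw [Finset.sum_range_succ]
    have h1 : β / 2 ^ (N + 1 + 1) ≤ β / 2 ^ (N + 1) := by gcongr <;> simp
    have h2 : β / 2 ^ (N + 1) ≤ β := div_le_self hβ.le (one_le_pow₀ (by norm_num))
    rw [← Set.Ioc_union_Ioc_eq_Ioc h1 h2,
      MeasureTheory.lintegral_union measurableSet_Ioc (Set.Ioc_disjoint_Ioc_of_le le_rfl), add_comm]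
    refine add_le_add ?_ ih
    have := mul_le_setLIntegral_Ioc hh (β / 2 ^ (N + 1 + 1)) (β / 2 ^ (N + 1))
    have e : β / 2 ^ (N + 1) - β / 2 ^ (N + 1 + 1) = β / 2 ^ (N + 1) / 2 := by
      rw [pow_succ _ (N + 1)]; field_simp; ring
    rwa [e] at this

/-- The bound for one value of `α`. With `β = R / 4`, three regimes occur. If `R ≤ 4 * α`, the
payoffs themselves are small enough. If `β / 2 < α < β`, the integral may be much smaller than the
entropy term at scale `β`, and the one-scale bound has to be combined with the trivial bound `R`.
If `α ≤ β / 2`, one chains down to the last scale `β / 2 ^ N` for which `β / 2 ^ (N + 1)` is still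
at least `α`. -/
theorem seqComplexity_le_integral {G : E → ℝ} {γ R α : ℝ} (hT : 1 ≤ T) (hα : 0 < α)
    (hG_nonneg : ∀ z, 0 ≤ G z) (hGadd : ∀ z w, G (z + w) ≤ G z + G w)
    (hG0 : G 0 = 0) (hGle : ∀ z, G z ≤ ‖z‖)
    (hS : UniformlySmooth γ 2 (fun z => G z ^ 2)) (hR : R ≤ 1)
    (hbound : ∀ φ ∈ Φ, ∀ (t : Fin T) (f : F) (x : X), ‖(φ t l f x : E)‖ ≤ R)
    (hrich : 2 ≤ coverNum l Φ (R / 4)) :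
    ENNReal.ofReal (seqComplexity l Φ (fun z => G ((T : ℝ)⁻¹ • ∑ t, z t))) ≤
      4 * (ENNReal.ofReal α + 6 * ENNReal.ofReal (√(γ / T)) *
        ∫⁻ β in Set.Ioc α 1, sqrtLog (coverNum l Φ β)) := by
  have hΦ := nonempty_of_coverNum hrich
  have hanti : Antitone fun β => sqrtLog (coverNum l Φ β) :=
    sqrtLog_mono.comp_antitone coverNum_antitone
  have hsmall : seqComplexity l Φ (fun z => G ((T : ℝ)⁻¹ • ∑ t, z t)) ≤ 4 * α →
      ENNReal.ofReal (seqComplexity l Φ (fun z => G ((T : ℝ)⁻¹ • ∑ t, z t))) ≤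
      4 * (ENNReal.ofReal α + 6 * ENNReal.ofReal (√(γ / T)) *
        ∫⁻ β in Set.Ioc α 1, sqrtLog (coverNum l Φ β)) := fun h => by
    calc _ ≤ ENNReal.ofReal (4 * α) := ENNReal.ofReal_le_ofReal h
      _ = 4 * ENNReal.ofReal α := by rw [ENNReal.ofReal_mul (by norm_num)]; simp
      _ ≤ _ := by gcongr; exact le_self_add
  rcases hS.1.eq_or_lt with hγ | hγ
  · -- Without curvature the self-bounding gradient at `0` vanishes, hence so does `G`.
    have hGz : ∀ z, G z = 0 := fun z => by
      obtain ⟨g, hg, hup⟩ := hS.exists_gradient (fun z => sq_nonneg (G z)) 0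
      have h1 := hg z
      have h2 := hup z
      simp only [← hγ, hG0, zero_add] at h1 h2
      have h3 : g z = 0 := by nlinarith
      rw [h3] at h2
      nlinarith [hG_nonneg z]
    refine hsmall (seqComplexity_le_of_majorant (by positivity) hΦ fun fx =>
      ⟨fun _ => 0, by simp; positivity, fun φ _ ε => (hGz _).le⟩)
  rcases le_or_gt R (4 * α) with hRα | hRα
  · exact hsmall (seqComplexity_le_bound hT (by positivity) hΦ hGle
      fun φ hφ t f x => (hbound φ hφ t f x).trans hRα)
  have hT' : (0 : ℝ) < T := by exact_mod_cast hT
  set s := √(γ / T) with hs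
  have hs0 : 0 < s := Real.sqrt_pos.2 (by positivity)
  set I := ∫⁻ β in Set.Ioc α 1, sqrtLog (coverNum l Φ β) with hI
  rcases eq_or_ne I ⊤ with hItop | hItop
  · rw [hItop, ENNReal.mul_top (by simpa using hs0), add_top, ENNReal.mul_top (by norm_num)]
    exact le_top
  -- From here on every covering number at a scale above `α` is finite.
  have hfin : ∀ b, α < b → b ≤ 1 → coverNum l Φ b ≠ ⊤ := fun b hb hb1 htop => hItop <| by
    have h1 : ENNReal.ofReal (b - α) * sqrtLog (coverNum l Φ b) ≤ I :=
      (mul_le_setLIntegral_Ioc hanti α b).trans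
        (MeasureTheory.lintegral_mono_set (Set.Ioc_subset_Ioc_right hb1))
    rw [htop, sqrtLog, if_pos rfl, ENNReal.mul_top (by simpa using hb)] at h1
    exact top_le_iff.1 h1
  have hsqrtLog : ∀ b, α < b → b ≤ 1 →
      sqrtLog (coverNum l Φ b) = ENNReal.ofReal √(Real.log (coverNum l Φ b).toNat) :=
    fun b hb hb1 => if_neg (hfin b hb hb1)
  -- It remains to find a real lower bound for the integral.
  suffices h : ∃ J : ℝ, 0 ≤ J ∧ ENNReal.ofReal J ≤ I ∧
      seqComplexity l Φ (fun z => G ((T : ℝ)⁻¹ • ∑ t, z t)) ≤ 4 * (α + 6 * s * J) by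
    obtain ⟨J, hJ0, hJI, hJ⟩ := h
    calc _ ≤ ENNReal.ofReal (4 * (α + 6 * s * J)) := ENNReal.ofReal_le_ofReal hJ
      _ = 4 * (ENNReal.ofReal α + 6 * ENNReal.ofReal s * ENNReal.ofReal J) := by
          rw [ENNReal.ofReal_mul (by norm_num), ENNReal.ofReal_add hα.le (by positivity),
            ENNReal.ofReal_mul (by positivity), ENNReal.ofReal_mul (by norm_num)]
          simp
      _ ≤ _ := by gcongr
  set β := R / 4 with hβ
  have hβα : α < β := by rw [hβ]; linarith
  have hβ0 : 0 < β := hα.trans hβα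
  have hβ1 : β ≤ 1 := by linarith
  have hbound' : ∀ φ ∈ Φ, ∀ (t : Fin T) (f : F) (x : X), ‖(φ t l f x : E)‖ ≤ 4 * β :=
    fun φ hφ t f x => (hbound φ hφ t f x).trans (by rw [hβ]; linarith)
  have hchain := seqComplexity_le_chain hT hγ hβ0 hG0 hGadd hGle hS hbound' hrich
  rcases lt_or_ge (β / 2) α with hα2 | hα2
  · have htriv := seqComplexity_le_bound hT (by positivity) hΦ hGle hbound'
    have h0 := hchain 0 (by simpa using hfin β hβα hβ1)
    simp only [zero_add, Finset.range_one, Finset.sum_singleton, pow_zero, div_one, ← hs] at h0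
    set a := √(Real.log (coverNum l Φ β).toNat) with ha
    have ha0 : 0 ≤ a := Real.sqrt_nonneg _
    -- With this `J` the right-hand side is affine in `α`, with slope `4 * (1 - 6 * s * a)`; so it is
    -- bounded below by its value at `β / 2` or at `β`, according to the sign of the slope.
    refine ⟨(β - α) * a, mul_nonneg (by linarith) ha0, ?_, ?_⟩
    · rw [ENNReal.ofReal_mul (by linarith), ha, ← hsqrtLog β hβα hβ1]
      exact (mul_le_setLIntegral_Ioc hanti α β).trans
        (MeasureTheory.lintegral_mono_set (Set.Ioc_subset_Ioc_right hβ1))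
    · rcases le_total (6 * (s * a)) 1 with h6 | h6
      · nlinarith [mul_nonneg (sub_nonneg.2 h6) (sub_nonneg.2 hα2.le),
          mul_nonneg (mul_nonneg hs0.le ha0) hβ0.le]
      · nlinarith [mul_nonneg (sub_nonneg.2 h6) (sub_nonneg.2 hβα.le)]
  · obtain ⟨N, hN1, hN2⟩ : ∃ N : ℕ, β / 2 ^ (N + 2) < α ∧ α ≤ β / 2 ^ (N + 1) := by
      obtain ⟨k, hk1, hk2⟩ := exists_nat_pow_near (x := β / 2 / α) (y := 2)
        ((one_le_div hα).2 hα2) (by norm_num)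
      refine ⟨k, ?_, ?_⟩
      · rw [div_lt_iff₀ hα] at hk2
        rw [div_lt_iff₀ (by positivity), pow_add, mul_comm]
        rw [pow_succ] at hk2
        linarith
      · rw [le_div_iff₀ hα] at hk1
        rw [le_div_iff₀ (by positivity), pow_succ]
        linarith
    have hscale : ∀ j ≤ N, α < β / 2 ^ j ∧ β / 2 ^ j ≤ 1 := fun j hj =>
      ⟨hN2.trans_lt (div_lt_div_of_pos_left hβ0 (by positivity)
        (pow_lt_pow_right₀ (by norm_num) (by lia))),
        (div_le_self hβ0.le (one_le_pow₀ (by norm_num))).trans hβ1⟩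
    have hc := hchain N (hfin _ (hscale N le_rfl).1 (hscale N le_rfl).2)
    rw [← hs] at hc
    set A := ∑ j ∈ Finset.range (N + 1),
      β / 2 ^ j * √(Real.log (coverNum l Φ (β / 2 ^ j)).toNat) with hA
    have hA0 : 0 ≤ A := Finset.sum_nonneg fun j _ => by positivity
    refine ⟨A / 2, by positivity, ?_, ?_⟩
    · refine le_trans (le_of_eq ?_) ((sum_dyadic_le_setLIntegral hanti hβ0 N).trans
        (MeasureTheory.lintegral_mono_set (Set.Ioc_subset_Ioc hN2 hβ1)))
      rw [hA, Finset.sum_div, ENNReal.ofReal_sum_of_nonneg fun j _ => by positivity]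
      refine Finset.sum_congr rfl fun j hj => ?_
      have hj' := hscale j (Finset.mem_range_succ_iff.1 hj)
      rw [hsqrtLog _ hj'.1 hj'.2, ← ENNReal.ofReal_mul (by positivity), mul_div_right_comm]
    · have h4 : β / 2 ^ N ≤ 4 * α := by
        rw [pow_add, ← div_div] at hN1
        linarith
      have : 0 ≤ s * A := by positivity
      linarith

end

end SeqDudley

theorem theorem3 {F X E : Type*} [NormedAddCommGroup E] [NormedSpace ℝ E]
    (H : Set E) (T : ℕ) (hT : 1 ≤ T)
    (l : F → X → H) (Φ : Set (Fin T → SeqDudley.PayoffTransformation F X H))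
    (G : E → ℝ) (γ R : ℝ)
    (hG_nonneg : ∀ z, 0 ≤ G z)
    (hG_subadd : ∀ z w, G (z + w) ≤ G z + G w)
    (hG_lip : LipschitzWith 1 G)
    (hG_zero : G 0 = 0)
    (hG_smooth : SeqDudley.UniformlySmooth γ 2 (fun z => G z ^ 2))
    (hR : R ≤ 1)
    (hbound : ∀ φ ∈ Φ, ∀ (t : Fin T) (f : F) (x : X), ‖(φ t l f x : E)‖ ≤ R)
    (hrich : 2 ≤ SeqDudley.coverNum l Φ (R / 4)) :
    ENNReal.ofReal
        (SeqDudley.seqComplexity l Φ (fun z => G ((T : ℝ)⁻¹ • ∑ t, z t))) ≤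
      4 * ⨅ (α : ℝ) (_ : 0 < α),
        (ENNReal.ofReal α + 6 * ENNReal.ofReal (Real.sqrt (γ / T)) *
          ∫⁻ β in Set.Ioc α 1, SeqDudley.sqrtLog (SeqDudley.coverNum l Φ β)) := by
  have hGle : ∀ z, G z ≤ ‖z‖ := fun z => by
    have h := hG_lip.dist_le_mul z 0
    rw [hG_zero, Real.dist_eq, sub_zero, abs_of_nonneg (hG_nonneg z), dist_zero_right] at h
    simpa using h
  rw [ENNReal.mul_iInf_of_ne (by norm_num) (by norm_num)]
  refine le_iInf fun α => ?_
  rw [ENNReal.mul_iInf_of_ne (by norm_num) (by norm_num)]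
  exact le_iInf fun hα => SeqDudley.seqComplexity_le_integral hT hα hG_nonneg hG_subadd hG_zero
    hGle hG_smooth hR hbound hrich
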